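/- A fair coin is flipped $n$ times independently. Bob scores one point for each occurrence of $HT$ (a head immediately followed by a tail) in the resulting sequence, and Alice scores one point for each occurrence of $HH$ (two consecutive heads, overlapping occurrences counted separately). Let $P_n(\mathrm{Bob})$ be the probability that Bob has strictly more points than Alice after $n$ flips, let $P_n(\mathrm{Alice})$ be the probability that Alice has strictly more points than Bob, and let $\Delta_n = P_n(\mathrm{Bob}) - P_n(\mathrm{Alice})$ for $n \ge 0$. Then for every complex number $t$ with $|t| < \tfrac12$ the series $f(t) = \sum_{n \ge 0} \Delta_n (2t)^n$ converges absolutely and $$f(t) = \frac12\,\frac{1}{\sqrt{(1-t)(1-2t)(2t^2+t+1)}} - \frac12\,\frac{1}{1-t},$$ where $\sqrt{\cdot}$ denotes the principal branch of the square root. -/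

import Mathlib

noncomputable section

namespace CoinGame

/-- A record of `n` coin flips; `true` is heads (`H`), `false` is tails (`T`). -/
abbrev Flips (n : ℕ) : Type := Fin n → Bool

/-- Number of (possibly overlapping) occurrences of the two consecutive outcomes `a`, `b`
in the record `ω`. -/
def pairCount {n : ℕ} (a b : Bool) (ω : Flips n) : ℕ :=
  (Finset.univ.filter fun p : Fin n × Fin n =>
    (p.2 : ℕ) = (p.1 : ℕ) + 1 ∧ ω p.1 = a ∧ ω p.2 = b).card

/-- Alice scores a point for each `HH`. -/
def aliceScore {n : ℕ} (ω : Flips n) : ℕ := pairCount true true ω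

/-- Bob scores a point for each `HT`. -/
def bobScore {n : ℕ} (ω : Flips n) : ℕ := pairCount true false ω

/-- The law of `n` independent flips of a fair coin: the uniform distribution on `{H, T}ⁿ`. -/
def fairLaw (n : ℕ) : MeasureTheory.Measure (Flips n) :=
  (PMF.uniformOfFintype (Flips n)).toMeasure

/-- Probability that Bob has strictly more points than Alice after `n` flips. -/
def probBob (n : ℕ) : ℝ := (fairLaw n).real {ω | aliceScore ω < bobScore ω}

/-- Probability that Alice has strictly more points than Bob after `n` flips. -/
def probAlice (n : ℕ) : ℝ := (fairLaw n).real {ω | bobScore ω < aliceScore ω}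

/-- The difference of the win probabilities after `n` flips. -/
def winDiff (n : ℕ) : ℝ := probBob n - probAlice n

end CoinGame

end

/-!
Let the lead be Bob's score minus Alice's, so that `2 ^ n * winDiff n` is the sum of the signs of
the lead over all records of length `n`. Given that the last flip was tails (`T`) or heads (`H`) and
that the lead is `k`, let `v T k` and `v H k` be the sums, over all continuations of length `m` and
over all `m`, of `t ^ m` times the sign of the final lead. Splitting off the next flip gives the
value equations
`v T k = sign k + t * (v H k + v T k)` and
`v H k = sign k + t * (v H (k - 1) + v T (k + 1))`,
and the generating function is `v T 0`, because the empty record behaves like one ending in tails.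

For `‖t‖ < 1 / 2` any bounded solution of these equations computes the generating function, since
unrolling them `N` times leaves a remainder of order `‖2 * t‖ ^ N`
(`CoinGame.hasSum_winDiff_of_bounded`). So it is enough to write one down. Eliminating `v T` leaves a
linear recurrence for `v H` with characteristic equation
`t ^ 2 * z ^ 2 - (1 - t) * z + t * (1 - t) = 0` and discriminant
`(1 - t) * (1 - 2 * t) * (2 * t ^ 2 + t + 1)`. For `t ≠ 0` one root lies in the unit disc and
the other outside, so the solution is a constant plus a decaying geometric term on each side of
`0`; matching the two sides at the origin determines it and gives the closed form
(`CoinGame.headValue_eq`, `CoinGame.exists_bounded_value`).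

For the branch of the square root, write the discriminant as
`(1 - t) ^ 2 * (1 - 4 * t ^ 3 / (1 - t))`. The second factor is within distance `1` of `1`, so it has
a square root `w` with argument below `π / 4` in absolute value; so has `1 - t`, hence
`(1 - t) * w` has positive real part and is the principal root.
-/

/-! ### Square roots of complex numbers -/

lemma Complex.sqrt_sq_of_re_pos {z : ℂ} (hz : 0 < z.re) : Complex.sqrt (z ^ 2) = z := by
  have h := abs_lt.mp (Complex.abs_arg_lt_pi_div_two_iff.mpr (Or.inl hz))
  have h2 := Complex.pow_cpow_nat_inv (x := z) (n := 2) two_ne_zero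
    (by push_cast; linarith [h.1]) (by push_cast; linarith [h.2])
  simpa [Complex.sqrt] using h2

/-- The square root can be taken in the open sector of half-angle `π / 4` around the positive
axis. -/
lemma Complex.exists_sq_eq_of_re_pos {x : ℂ} (hx : 0 < x.re) :
    ∃ w : ℂ, w ^ 2 = x ∧ |w.im| < w.re := by
  obtain ⟨w, hw⟩ := IsAlgClosed.exists_pow_nat_eq x (n := 2) (by norm_num)
  have key : ∀ z : ℂ, z ^ 2 = x → |z.im| < |z.re| := fun z hz => by
    rw [← sq_lt_sq]
    have : (z ^ 2).re = z.re ^ 2 - z.im ^ 2 := by simp [pow_two]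
    rw [hz] at this
    linarith
  rcases le_total 0 w.re with h | h
  · exact ⟨w, hw, by simpa [abs_of_nonneg h] using key w hw⟩
  · refine ⟨-w, by simpa using hw, ?_⟩
    simpa [abs_of_nonpos h] using key w hw

/-- Two numbers with argument below `π / 4` in absolute value have a product with positive real
part. -/
lemma Complex.mul_re_pos_of_abs_im_lt {z w : ℂ} (hz : |z.im| < z.re) (hw : |w.im| < w.re) :
    0 < (z * w).re := by
  have h : z.im * w.im < z.re * w.re := by
    calc z.im * w.im ≤ |z.im * w.im| := le_abs_self _
      _ = |z.im| * |w.im| := abs_mul _ _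
      _ < z.re * w.re := mul_lt_mul'' hz hw (abs_nonneg _) (abs_nonneg _)
  simpa using h

namespace CoinGame

/-! ### Scores after one more flip -/

/-- The last flip of a record. The empty record counts as ending in tails: as after a tail, the
next flip scores for nobody. -/
def lastFlip : {n : ℕ} → Flips n → Bool
  | 0, _ => false
  | n + 1, ω => ω (Fin.last n)

/-- Bob's score minus Alice's score. -/
def lead {n : ℕ} (ω : Flips n) : ℤ := bobScore ω - aliceScore ω

lemma pairCount_snoc {n : ℕ} (a b : Bool) (ω : Flips n) (x : Bool) :
    pairCount a b (Fin.snoc ω x : Flips (n + 1)) =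
      pairCount a b ω + if n ≠ 0 ∧ lastFlip ω = a ∧ x = b then 1 else 0 := by
  have key : ∑ i : Fin n, (if n = (i : ℕ) + 1 ∧ ω i = a ∧ x = b then 1 else 0) =
      if n ≠ 0 ∧ lastFlip ω = a ∧ x = b then 1 else 0 := by
    cases n with
    | zero => simp
    | succ m =>
      rw [Fin.sum_univ_castSucc, Finset.sum_eq_zero]
      · simp [lastFlip]
      · intro i _
        rw [if_neg]
        rintro ⟨h, -⟩
        have := i.isLt
        simp at h
        omega
  have hlast : ∀ j : Fin n, (j : ℕ) ≠ n + 1 := fun j => by omega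
  simp only [pairCount, Finset.card_filter, Fintype.sum_prod_type, Fin.sum_univ_castSucc]
  simp [Finset.sum_add_distrib, hlast, key]

lemma lastFlip_snoc {n : ℕ} (ω : Flips n) (x : Bool) :
    lastFlip (Fin.snoc ω x : Flips (n + 1)) = x := by
  simp [lastFlip]

lemma ne_zero_of_lastFlip {n : ℕ} {ω : Flips n} (h : lastFlip ω = true) : n ≠ 0 := by
  rintro rfl
  simp [lastFlip] at h

lemma lead_snoc {n : ℕ} (ω : Flips n) (x : Bool) :
    lead (Fin.snoc ω x : Flips (n + 1)) =
      lead ω + if lastFlip ω then (if x then -1 else 1) else 0 := by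
  have := @ne_zero_of_lastFlip n ω
  simp only [lead, aliceScore, bobScore, pairCount_snoc]
  cases h : lastFlip ω <;> cases x <;> simp_all <;> ring

lemma sum_flips_succ {M : Type*} [AddCommMonoid M] {n : ℕ} (F : Flips (n + 1) → M) :
    ∑ ω, F ω = ∑ ω : Flips n, (F (Fin.snoc ω true) + F (Fin.snoc ω false)) := by
  rw [← (Fin.snocEquiv fun _ : Fin (n + 1) => Bool).sum_comp F, Fintype.sum_prod_type_right]
  simp [Fin.snocEquiv]

/-! ### Win probabilities as counts -/

lemma fairLaw_real (n : ℕ) (s : Set (Flips n)) [DecidablePred (· ∈ s)] :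
    (fairLaw n).real s = (Finset.univ.filter (· ∈ s)).card / 2 ^ n := by
  rw [MeasureTheory.measureReal_def, fairLaw,
    PMF.toMeasure_uniformOfFintype_apply (hs := s.toFinite.measurableSet), Fintype.card_subtype]
  simp

lemma winDiff_mul_two_pow (n : ℕ) :
    winDiff n * 2 ^ n = ∑ ω : Flips n, ((lead ω).sign : ℝ) := by
  have h : ∀ ω : Flips n, ((lead ω).sign : ℝ) =
      (if aliceScore ω < bobScore ω then 1 else 0) -
        (if bobScore ω < aliceScore ω then 1 else 0) := fun ω => by
    rcases lt_trichotomy (aliceScore ω) (bobScore ω) with h | h | h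
    · rw [Int.sign_eq_one_of_pos (by rw [lead]; omega)]
      simp [h, h.not_gt]
    · simp [lead, h]
    · rw [Int.sign_eq_neg_one_of_neg (by rw [lead]; omega)]
      simp [h, h.not_gt]
  simp only [winDiff, probBob, probAlice, fairLaw_real, h, Finset.sum_sub_distrib,
    Finset.sum_boole, Set.mem_ofPred_eq]
  field_simp

lemma abs_winDiff_le_one (n : ℕ) : |winDiff n| ≤ 1 := by
  have : MeasureTheory.IsProbabilityMeasure (fairLaw n) := by unfold fairLaw; infer_instance
  have h1 : probBob n ≤ 1 := MeasureTheory.measureReal_le_one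
  have h2 : probAlice n ≤ 1 := MeasureTheory.measureReal_le_one
  have h3 : 0 ≤ probBob n := MeasureTheory.measureReal_nonneg
  have h4 : 0 ≤ probAlice n := MeasureTheory.measureReal_nonneg
  rw [abs_le, winDiff]
  constructor <;> linarith

/-! ### The value equations and the generating function -/

/-- Unrolling the value equations `N` times: each step replaces the value at a record by the sign of
its lead plus `t` times the values at its two extensions. -/
lemma sum_winDiff_add_remainder {t : ℂ} {v : Bool → ℤ → ℂ}
    (hT : ∀ k, v false k = (k.sign : ℂ) + t * (v true k + v false k))
    (hH : ∀ k, v true k = (k.sign : ℂ) + t * (v true (k - 1) + v false (k + 1))) (N : ℕ) :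
    ∑ n ∈ Finset.range N, (winDiff n : ℂ) * (2 * t) ^ n +
      t ^ N * ∑ ω : Flips N, v (lastFlip ω) (lead ω) = v false 0 := by
  induction N with
  | zero => simp [lastFlip, lead, aliceScore, bobScore, pairCount]
  | succ N ih =>
    have hstep : ∀ ω : Flips N, v (lastFlip ω) (lead ω) = ((lead ω).sign : ℂ) +
        t * (v (lastFlip (Fin.snoc ω true : Flips (N + 1)))
            (lead (Fin.snoc ω true : Flips (N + 1))) +
          v (lastFlip (Fin.snoc ω false : Flips (N + 1)))
            (lead (Fin.snoc ω false : Flips (N + 1)))) := fun ω => by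
      simp only [lastFlip_snoc, lead_snoc]
      cases lastFlip ω
      · simpa using hT (lead ω)
      · simpa [sub_eq_add_neg] using hH (lead ω)
    have hW : (winDiff N : ℂ) * 2 ^ N = ∑ ω : Flips N, ((lead ω).sign : ℂ) := by
      exact_mod_cast congrArg (fun x : ℝ => (x : ℂ)) (winDiff_mul_two_pow N)
    rw [← ih, Finset.sum_range_succ, sum_flips_succ, Finset.sum_congr rfl fun ω _ => hstep ω,
      Finset.sum_add_distrib (f := fun ω => ((lead ω).sign : ℂ)), ← hW, ← Finset.mul_sum]
    ring

/-- For any bounded solution of the value equations, the value at the start of the game is the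
generating function: the remainder after `N` steps is at most `‖2 * t‖ ^ N` times the bound. -/
lemma hasSum_winDiff_of_bounded {t : ℂ} (ht : ‖t‖ < 1 / 2) {v : Bool → ℤ → ℂ} {C : ℝ}
    (hC : ∀ s k, ‖v s k‖ ≤ C)
    (hT : ∀ k, v false k = (k.sign : ℂ) + t * (v true k + v false k))
    (hH : ∀ k, v true k = (k.sign : ℂ) + t * (v true (k - 1) + v false (k + 1))) :
    HasSum (fun n : ℕ => (winDiff n : ℂ) * (2 * t) ^ n) (v false 0) := by
  have h2t : ‖2 * t‖ < 1 := by
    rw [norm_mul, RCLike.norm_ofNat]; linarith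
  have hsum : Summable fun n : ℕ => (winDiff n : ℂ) * (2 * t) ^ n := by
    refine .of_norm_bounded (summable_geometric_of_lt_one (norm_nonneg _) h2t) fun n => ?_
    rw [norm_mul, norm_pow, Complex.norm_real]
    exact mul_le_of_le_one_left (by positivity) (abs_winDiff_le_one n)
  have hrem : Filter.Tendsto (fun N : ℕ => t ^ N * ∑ ω : Flips N, v (lastFlip ω) (lead ω))
      Filter.atTop (nhds 0) := by
    have hgeom := (tendsto_pow_atTop_nhds_zero_of_lt_one (norm_nonneg _) h2t).mul_const C
    rw [zero_mul] at hgeom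
    refine squeeze_zero_norm (fun N => ?_) hgeom
    have : ‖∑ ω : Flips N, v (lastFlip ω) (lead ω)‖ ≤ 2 ^ N * C := by
      refine (norm_sum_le_of_le _ fun ω _ => hC _ _).trans ?_
      simp
    calc _ ≤ ‖t‖ ^ N * (2 ^ N * C) := by rw [norm_mul, norm_pow]; gcongr
      _ = ‖2 * t‖ ^ N * C := by rw [norm_mul, RCLike.norm_ofNat, mul_pow]; ring
  rw [hsum.hasSum_iff_tendsto_nat]
  have := (tendsto_const_nhds (x := v false 0)).sub hrem
  rw [sub_zero] at this
  exact this.congr fun N => by rw [← sum_winDiff_add_remainder hT hH N]; ring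

/-! ### An explicit bounded solution of the value equations -/

/-- The candidate for the value function after a head, as a function of the lead. It approaches the
constants `c` and `-c`, the values when the sign never changes again, geometrically in both
directions, with ratio `r` for nonnegative and `q` for negative leads. The value at lead `0` is `h`,
and that at lead `-1` is `-c + g`. -/
def headValue (c h r q g : ℂ) : ℤ → ℂ
  | (k : ℕ) => c + (h - c) * r ^ k
  | Int.negSucc k => -c + g * q ^ k

lemma norm_headValue_le (c h g : ℂ) {r q : ℂ} (hr : ‖r‖ ≤ 1) (hq : ‖q‖ ≤ 1) (k : ℤ) :
    ‖headValue c h r q g k‖ ≤ ‖c‖ + ‖h - c‖ + ‖g‖ := by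
  rcases k with k | k
  · have h1 : ‖(h - c) * r ^ k‖ ≤ ‖h - c‖ := by
      rw [norm_mul, norm_pow]
      exact mul_le_of_le_one_right (norm_nonneg _) (pow_le_one₀ (norm_nonneg _) hr)
    have h2 := norm_add_le c ((h - c) * r ^ k)
    change ‖c + (h - c) * r ^ k‖ ≤ _
    linarith [norm_nonneg g]
  · have h1 : ‖g * q ^ k‖ ≤ ‖g‖ := by
      rw [norm_mul, norm_pow]
      exact mul_le_of_le_one_right (norm_nonneg _) (pow_le_one₀ (norm_nonneg _) hq)
    have h2 := norm_add_le (-c) (g * q ^ k)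
    rw [norm_neg] at h2
    change ‖-c + g * q ^ k‖ ≤ _
    linarith [norm_nonneg (h - c)]

/-- The value equation after a head, with the value `i * (sign k + t * headValue k)` after a tail
already eliminated. Away from the origin it says that `r` and `q⁻¹` are the roots `z` of
`z = t + t ^ 2 * i * z ^ 2`; at `k = 0` and `k = -1`, where the sign changes, it fixes the two free
coefficients. The parameters are `i = (1 - t)⁻¹`, `c = (1 - 2 * t)⁻¹`, `u = (1 + w) / 2` and
`y = w⁻¹`, where `w ^ 2 = 1 - 4 * t ^ 3 * i`. -/
lemma headValue_eq {t i c u r q y : ℂ} (hi : (1 - t) * i = 1) (hc : (1 - 2 * t) * c = 1)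
    (hr : r * u = t) (hq : q = t * i * r) (hu : t * q = 1 - u) (hy : (2 * u - 1) * y = 1) (k : ℤ) :
    headValue c (q * y) r q (c * q + t * i * y) k = (k.sign : ℂ) +
      t * (i * (((k + 1).sign : ℂ) + t * headValue c (q * y) r q (c * q + t * i * y) (k + 1)) +
        headValue c (q * y) r q (c * q + t * i * y) (k - 1)) := by
  have hr2 : r = t + t ^ 2 * i * r ^ 2 := by
    linear_combination hr - r * hu + t * r * hq
  have hq2 : q = t ^ 2 * i + t * q ^ 2 := by
    linear_combination t * i * hr - q * hu + u * hq
  rcases k with (_ | k) | (_ | k)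
  · change c + (q * y - c) * r ^ 0 = ((Int.sign 0 : ℤ) : ℂ) +
      t * (i * (((0 + 1 : ℤ).sign : ℂ) + t * (c + (q * y - c) * r ^ 1)) +
        (-c + (c * q + t * i * y) * q ^ 0))
    simp
    linear_combination y * hq2 - t * c * hi + t * i * hc + t * (q * y - c) * hq
  · rw [show (Int.ofNat (k + 1) - 1 : ℤ) = Int.ofNat k by simp]
    change c + (q * y - c) * r ^ (k + 1) = ((Int.sign ((k + 1 : ℕ) : ℤ) : ℤ) : ℂ) +
      t * (i * (((((k + 1 : ℕ) : ℤ) + 1).sign : ℂ) + t * (c + (q * y - c) * r ^ (k + 2))) +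
        (c + (q * y - c) * r ^ k))
    rw [Int.sign_eq_one_of_pos (by omega), Int.sign_eq_one_of_pos (by omega)]
    simp
    linear_combination (1 + t * i) * hc - t * c * hi + (q * y - c) * r ^ k * hr2
  · change -c + (c * q + t * i * y) * q ^ 0 = ((Int.sign (-1) : ℤ) : ℂ) +
      t * (i * (((-1 + 1 : ℤ).sign : ℂ) + t * (c + (q * y - c) * r ^ 0)) +
        (-c + (c * q + t * i * y) * q ^ 1))
    simp
    linear_combination c * hq2 + t * i * hy - 2 * t * i * y * hu - (1 + t * i) * hc + t * c * hi
  · change -c + (c * q + t * i * y) * q ^ (k + 1) = ((Int.sign (Int.negSucc (k + 1)) : ℤ) : ℂ) +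
      t * (i * (((Int.negSucc k).sign : ℂ) + t * (-c + (c * q + t * i * y) * q ^ k)) +
        (-c + (c * q + t * i * y) * q ^ (k + 2)))
    simp
    linear_combination -(1 + t * i) * hc + t * c * hi + (c * q + t * i * y) * q ^ k * hq2

/-- The value equations have a bounded solution, whose value at the start of the game is the closed
form. Here `s = true` is the state after a head and `k` is the lead. -/
lemma exists_bounded_value {t : ℂ} (ht : ‖t‖ < 1 / 2) :
    ∃ v : Bool → ℤ → ℂ, (∃ C, ∀ s k, ‖v s k‖ ≤ C) ∧
      (∀ k, v false k = (k.sign : ℂ) + t * (v true k + v false k)) ∧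
      (∀ k, v true k = (k.sign : ℂ) + t * (v true (k - 1) + v false (k + 1))) ∧
      v false 0 = (1 / 2) * (1 / Complex.sqrt ((1 - t) * (1 - 2 * t) * (2 * t ^ 2 + t + 1)))
        - (1 / 2) * (1 / (1 - t)) := by
  have hn : 1 - ‖t‖ ≤ ‖1 - t‖ := by simpa using norm_sub_norm_le (1 : ℂ) t
  have h1t : 1 - t ≠ 0 := by
    rw [← norm_pos_iff]; linarith
  have h12t : 1 - 2 * t ≠ 0 := by
    rw [← norm_pos_iff]
    have := norm_sub_norm_le (1 : ℂ) (2 * t)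
    simp only [norm_one, norm_mul, RCLike.norm_ofNat] at this
    linarith
  have hsmall : ‖4 * t ^ 3 / (1 - t)‖ < 1 := by
    rw [norm_div, div_lt_one (by linarith), norm_mul, norm_pow]
    have : ‖t‖ ^ 3 ≤ (1 / 2) ^ 3 := by gcongr
    norm_num at this ⊢
    linarith
  -- `(1 - t) * w` is a square root of the discriminant; the choice of `w` near the positive axis
  -- makes it the principal one and makes both `r` and `q` small.
  obtain ⟨w, hw, hwre⟩ := Complex.exists_sq_eq_of_re_pos (x := 1 - 4 * t ^ 3 / (1 - t)) (by
    have := (Complex.re_le_norm _).trans_lt hsmall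
    rw [Complex.sub_re, Complex.one_re]
    linarith)
  have hwpos : 0 < w.re := (abs_nonneg _).trans_lt hwre
  have hw0 : w ≠ 0 := by rintro rfl; simp at hwpos
  have hn1w : 1 < ‖1 + w‖ := by
    have := Complex.re_le_norm (1 + w)
    rw [Complex.add_re, Complex.one_re] at this
    linarith
  have h1w : 1 + w ≠ 0 := by rw [← norm_pos_iff]; linarith
  have hsqrt : Complex.sqrt ((1 - t) * (1 - 2 * t) * (2 * t ^ 2 + t + 1)) = (1 - t) * w := by
    rw [← Complex.sqrt_sq_of_re_pos (z := (1 - t) * w)]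
    · congr 1
      rw [mul_pow, hw]
      field_simp
      ring
    · refine Complex.mul_re_pos_of_abs_im_lt ?_ hwre
      have h1 := Complex.abs_re_le_norm t
      have h2 := Complex.abs_im_le_norm t
      have h3 := le_abs_self t.re
      simp only [Complex.sub_im, Complex.one_im, zero_sub, abs_neg, Complex.sub_re, Complex.one_re]
      linarith
  obtain ⟨i, hi⟩ : ∃ i, (1 - t) * i = 1 := ⟨_, mul_inv_cancel₀ h1t⟩
  obtain ⟨c, hc⟩ : ∃ c, (1 - 2 * t) * c = 1 := ⟨_, mul_inv_cancel₀ h12t⟩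
  obtain ⟨y, hy⟩ : ∃ y, w * y = 1 := ⟨_, mul_inv_cancel₀ hw0⟩
  obtain ⟨r, hr⟩ : ∃ r, r * (1 + w) = 2 * t := ⟨_, div_mul_cancel₀ _ h1w⟩
  obtain ⟨q, hq⟩ : ∃ q, q = t * i * r := ⟨_, rfl⟩
  have hrn : ‖r‖ ≤ 1 := by
    have := congrArg norm hr
    rw [norm_mul, norm_mul, RCLike.norm_ofNat] at this
    nlinarith [norm_nonneg r]
  have hqn : ‖q‖ ≤ 1 := by
    have hin : ‖t * i‖ ≤ 1 := by
      have := congrArg norm hi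
      rw [norm_mul, norm_one] at this
      rw [norm_mul]
      nlinarith [norm_nonneg i]
    rw [hq, norm_mul]
    exact mul_le_one₀ hin (norm_nonneg _) hrn
  have hw' : w ^ 2 = 1 - 4 * t ^ 3 * i := by
    rw [hw, eq_inv_of_mul_eq_one_right hi, div_eq_mul_inv]
  have hu : t * q = 1 - (1 + w) / 2 := by
    apply mul_right_cancel₀ h1w
    rw [hq]
    linear_combination t ^ 2 * i * hr + hw' / 2
  have hE := headValue_eq hi hc (r := r) (u := (1 + w) / 2) (q := q) (y := y)
    (by linear_combination hr / 2) hq hu (by linear_combination hy)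
  set h := headValue c (q * y) r q (c * q + t * i * y) with h_def
  refine ⟨fun s k => if s then h k else i * ((k.sign : ℂ) + t * h k), ?_, ?_, ?_, ?_⟩
  · obtain ⟨C, hC⟩ : ∃ C, ∀ k, ‖h k‖ ≤ C := ⟨_, norm_headValue_le _ _ _ hrn hqn⟩
    refine ⟨max C (‖i‖ * (1 + ‖t‖ * C)), fun s k => ?_⟩
    cases s
    · refine le_max_of_le_right ?_
      have hs : ‖(k.sign : ℂ)‖ ≤ 1 := by
        rcases lt_trichotomy k 0 with hk | rfl | hk
        · simp [Int.sign_eq_neg_one_of_neg hk]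
        · simp
        · simp [Int.sign_eq_one_of_pos hk]
      simp only [Bool.false_eq_true, if_false, norm_mul]
      gcongr
      refine (norm_add_le _ _).trans ?_
      rw [norm_mul]
      gcongr
      exact hC k
    · exact le_max_of_le_left (by simpa using hC k)
  · intro k
    simp only [Bool.false_eq_true, if_false, if_true]
    linear_combination ((k.sign : ℂ) + t * h k) * hi
  · intro k
    simp only [Bool.false_eq_true, if_false, if_true]
    rw [hE k]
    ring
  · have h0 : h 0 = q * y := by
      change c + (q * y - c) * r ^ 0 = q * y
      ring
    have hi' : (1 - t)⁻¹ = i := (eq_inv_of_mul_eq_one_right hi).symm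
    have hy' : w⁻¹ = y := (eq_inv_of_mul_eq_one_right hy).symm
    simp only [Bool.false_eq_true, if_false, hsqrt, h0, Int.sign_zero, Int.cast_zero, one_div,
      mul_inv, hi', hy']
    linear_combination i * y * hu - i / 2 * hy

end CoinGame

/-- The generating function of the win probability differences, on the disc `|t| < 1 / 2`;
`Complex.sqrt` is the principal square root, and `HasSum` includes the convergence. -/
theorem mainTheorem1 (t : ℂ) (ht : ‖t‖ < 1 / 2) :
    HasSum (fun n : ℕ => (CoinGame.winDiff n : ℂ) * (2 * t) ^ n)
      ((1 / 2) * (1 / Complex.sqrt ((1 - t) * (1 - 2 * t) * (2 * t ^ 2 + t + 1)))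
        - (1 / 2) * (1 / (1 - t))) := by
  obtain ⟨v, ⟨C, hC⟩, hT, hH, hv⟩ := CoinGame.exists_bounded_value ht
  rw [← hv]
  exact CoinGame.hasSum_winDiff_of_bounded ht hC hT hH
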